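/- Let $q\ge 2$ be an integer and let $\mathcal X$ be a homogeneous tree of degree $q+1$ (a connected graph without cycles in which every vertex has $q+1$ neighbours), with graph distance $d$, a fixed base vertex $o$, and $|x|=d(o,x)$. Let $\Omega$ be the set of infinite geodesic rays $\omega=(\omega_0,\omega_1,\dots)$ with $\omega_0=o$. For $x\in\mathcal X$ and $\omega\in\Omega$ let $c(x,\omega)$ be the last vertex of the geodesic path from $o$ to $x$ that lies on $\omega$, and let $E(x)=\{\omega\in\Omega:|c(x,\omega)|\ge|x|\}$ be the set of rays through $x$. Let $\nu$ be the probability measure on the $\sigma$-algebra generated by the sets $E(x)$ with $\nu(E(o))=1$ and $\nu(E(x))=\frac{1}{(q+1)q^{|x|-1}}$ for $x\ne o$, and let $L^r(\Omega)=L^r(\Omega,\nu)$ (complex-valued functions). The Poisson kernel is $p(x,\omega)=q^{2|c(x,\omega)|-|x|}$, and for $z\in\mathbb C$ and $F\in L^1(\Omega)$ the Poisson transform is $$\mathcal P_zF(x)=\int_\Omega p(x,\omega)^{1/2+iz}F(\omega)\,d\nu(\omega),\qquad x\in\mathcal X.$$ Let $\phi_z=\mathcal P_z\mathbf 1$, which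 depends only on $|x|$; write $\phi_z(n)$ for its value on $S(o,n)=\{x:|x|=n\}$. For $1\le p\le 2$ put $\delta_p=\frac1p-\frac12$ and $\delta_{p'}=-\delta_p$; one has $\phi_{i\delta_p}>0$. For $u:\mathcal X\to\mathbb C$ define $$\|u\|_{\mathcal H^r_p(\mathcal X)}=\sup_{n\ge 0}\ \phi_{i\delta_p}(n)^{-1}\Bigl(\frac1{\#S(o,n)}\sum_{|x|=n}|u(x)|^r\Bigr)^{1/r}\quad(1\le r<\infty),\qquad \|u\|_{\mathcal H^\infty_p(\mathcal X)}=\sup_{x\in\mathcal X}\phi_{i\delta_p}(x)^{-1}|u(x)|.$$ (The average over $S(o,n)$ is the integral $\int_K|u(k\cdot\omega_n)|^r\,dk$ over the stabilizer $K$ of $o$ in the isometry group of $\mathcal X$, with normalized Haar measure, for any ray $(\omega_n)\in\Omega$.) Let $\tau=2\pi/\log q$. **Proposition.** Let $1\le p\le 2$. There is a constant $C_p>0$, depending only on $p$, such that for every $z=\alpha+i\delta_{p'}$, where $\alpha\in\mathbb R$ is arbitrary if $1\le p<2$ and $\alpha\in(\tau/2)\mathbb Z$ if $p=2$, $$C_p\,\|F\|_{L^r(\Omega)}\le\|\mathcal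 P_zF\|_{\mathcal H^r_p(\mathcal X)}\le\|F\|_{L^r(\Omega)}\qquad\text{for all }1\le r\le\infty\text{ and all }F\in L^r(\Omega).$$ -/

import Mathlib

open MeasureTheory
open scoped ENNReal

/-- `G` is a homogeneous tree of degree `q + 1`, with `q ≥ 2`. -/
structure IsHomogeneousTree {V : Type*} (G : SimpleGraph V) (q : ℕ) : Prop where
  isTree : G.IsTree
  two_le : 2 ≤ q
  ncard_neighborSet : ∀ v, (G.neighborSet v).ncard = q + 1

/-- The boundary `Ω` of the tree: infinite geodesic rays `ω₀, ω₁, ω₂, …` starting from `o`. -/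
structure TreeBoundary {V : Type*} (G : SimpleGraph V) (o : V) where
  vertex : ℕ → V
  vertex_zero : vertex 0 = o
  adj : ∀ n, G.Adj (vertex n) (vertex (n + 1))
  geodesic : ∀ m k, G.dist (vertex m) (vertex (m + k)) = k

namespace TreeBoundary

variable {V : Type*} {G : SimpleGraph V} {o : V} {q : ℕ}

/-- `c(x, ω)`: the last vertex of `ω` that lies on the geodesic path from `o` to `x`. A vertex `v`
lies on that path iff `d(o, v) + d(v, x) = d(o, x)`. -/
noncomputable def confluence (x : V) (ω : TreeBoundary G o) : V :=
  ω.vertex (sSup {j : ℕ | G.dist o (ω.vertex j) + G.dist (ω.vertex j) x = G.dist o x})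

/-- The sector `E_j(x) = {ω : |c(x, ω)| ≥ j}`. -/
def sectorFrom (G : SimpleGraph V) (o : V) (j : ℕ) (x : V) : Set (TreeBoundary G o) :=
  {ω | j ≤ G.dist o (confluence x ω)}

/-- The sector `E(x) = E_{|x|}(x)`. -/
def sector (G : SimpleGraph V) (o : V) (x : V) : Set (TreeBoundary G o) :=
  sectorFrom G o (G.dist o x) x

/-- The σ-algebra on `Ω` is generated by the sectors `E(x)`. -/
instance : MeasurableSpace (TreeBoundary G o) :=
  MeasurableSpace.generateFrom (Set.range (sector G o))

/-- The reciprocal of the number of vertices at distance `n` from `o`: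
`1` if `n = 0`, and `1 / ((q + 1) q ^ (n - 1))` otherwise. -/
noncomputable def sphereWeight (q n : ℕ) : ℝ≥0∞ :=
  if n = 0 then 1 else (((q : ℝ≥0∞) + 1) * (q : ℝ≥0∞) ^ (n - 1))⁻¹

theorem dist_vertex (ω : TreeBoundary G o) (n : ℕ) : G.dist o (ω.vertex n) = n := by
  have h := ω.geodesic 0 n
  rwa [ω.vertex_zero, zero_add] at h

/-- `E(x)` consists of the rays through `x`. -/
theorem mem_sector_iff (hG : G.Connected) (x : V) (ω : TreeBoundary G o) :
    ω ∈ sector G o x ↔ ω.vertex (G.dist o x) = x := by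
  set S : Set ℕ := {j : ℕ | G.dist o (ω.vertex j) + G.dist (ω.vertex j) x = G.dist o x} with hS
  have hb : ∀ j ∈ S, j ≤ G.dist o x := by
    intro j hj
    have hj' : G.dist o (ω.vertex j) + G.dist (ω.vertex j) x = G.dist o x := hj
    rw [dist_vertex] at hj'
    omega
  have hbdd : BddAbove S := ⟨_, hb⟩
  have h0 : (0 : ℕ) ∈ S := by simp [hS, ω.vertex_zero]
  have hmem : sSup S ∈ S := Nat.sSup_mem ⟨0, h0⟩ hbdd
  have key : ω ∈ sector G o x ↔ G.dist o x ≤ sSup S := by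
    change G.dist o x ≤ G.dist o (ω.vertex (sSup S)) ↔ _
    rw [dist_vertex]
  rw [key]
  constructor
  · intro h
    have he : sSup S = G.dist o x := le_antisymm (hb _ hmem) h
    rw [he] at hmem
    have hm : G.dist o (ω.vertex (G.dist o x)) + G.dist (ω.vertex (G.dist o x)) x
      = G.dist o x := hmem
    rw [dist_vertex] at hm
    exact hG.dist_eq_zero_iff.1 (by omega)
  · intro h
    refine le_csSup hbdd ?_
    change G.dist o (ω.vertex (G.dist o x)) + G.dist (ω.vertex (G.dist o x)) x = G.dist o x
    rw [h]; simp

theorem parent_unique (hG : G.IsTree) {x u u' : V} (h : G.Adj u x) (h' : G.Adj u' x)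
    (hd : G.dist o x = G.dist o u + 1) (hd' : G.dist o x = G.dist o u' + 1) : u = u' := by
  obtain ⟨p, hp⟩ := hG.connected.exists_walk_length_eq_dist o u
  obtain ⟨p', hp'⟩ := hG.connected.exists_walk_length_eq_dist o u'
  have e : p.concat h = p'.concat h' := by
    refine (hG.existsUnique_path o x).unique ?_ ?_ <;>
      refine SimpleGraph.Walk.isPath_of_length_eq_dist _ ?_ <;>
      rw [SimpleGraph.Walk.length_concat] <;> omega
  have e2 := congrArg SimpleGraph.Walk.penultimate e
  simpa using e2

theorem exists_parent (hG : G.Connected) {x : V} {n : ℕ} (h : G.dist o x = n + 1) :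
    ∃ u, G.Adj u x ∧ G.dist o u = n := by
  obtain ⟨p, hp⟩ := hG.exists_walk_length_eq_dist o x
  have hnil : ¬ p.Nil := by
    intro hn
    have := SimpleGraph.Walk.length_eq_zero_iff.2 hn
    omega
  refine ⟨p.penultimate, p.adj_penultimate hnil, ?_⟩
  have h1 : G.dist o p.penultimate ≤ n := by
    refine (SimpleGraph.dist_le p.dropLast).trans ?_
    rw [SimpleGraph.Walk.length_dropLast]; omega
  have h2 := hG.dist_triangle (u := o) (v := p.penultimate) (w := x)
  rw [SimpleGraph.dist_eq_one_iff_adj.2 (p.adj_penultimate hnil)] at h2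
  omega

theorem vertex_eq_of_le (hG : G.IsTree) {ω ω' : TreeBoundary G o} {n : ℕ}
    (h : ω.vertex n = ω'.vertex n) {m : ℕ} (hm : m ≤ n) : ω.vertex m = ω'.vertex m := by
  induction n with
  | zero => obtain rfl : m = 0 := by omega
            exact h
  | succ n ih =>
    rcases Nat.lt_or_ge n m with hlt | hge
    · obtain rfl : m = n + 1 := by omega
      exact h
    · refine ih ?_ hge
      have a := ω.adj n
      rw [h] at a
      refine parent_unique (o := o) hG a (ω'.adj n) ?_ ?_ <;> simp only [dist_vertex]

theorem sector_self (hG : G.Connected) : sector G o o = Set.univ := by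
  ext ω
  simp [mem_sector_iff hG, ω.vertex_zero]

theorem isPiSystem_sector (hG : G.IsTree) : IsPiSystem (Set.range (sector G o)) := by
  have key : ∀ x y, G.dist o x ≤ G.dist o y → (sector G o x ∩ sector G o y).Nonempty →
      sector G o x ∩ sector G o y = sector G o y := by
    rintro x y hxy ⟨ω, hx, hy⟩
    refine Set.inter_eq_right.2 fun ω' hω' => ?_
    rw [mem_sector_iff hG.connected] at *
    rw [← vertex_eq_of_le hG (hy.trans hω'.symm) hxy, hx]
  rintro _ ⟨x, rfl⟩ _ ⟨y, rfl⟩ h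
  rcases le_total (G.dist o x) (G.dist o y) with hle | hle
  · exact ⟨y, (key x y hle h).symm⟩
  · rw [Set.inter_comm] at h ⊢
    exact ⟨x, (key y x hle h).symm⟩

/-- The vertices following `v` on the rays from `o` through `v`. -/
def children (G : SimpleGraph V) (o v : V) : Set V :=
  {w | G.Adj v w ∧ G.dist o w = G.dist o v + 1}

theorem finite_children (hG : IsHomogeneousTree G q) (v : V) : (children G o v).Finite :=
  (Set.finite_of_ncard_ne_zero (s := G.neighborSet v)
    (by rw [hG.ncard_neighborSet]; omega)).subset fun _ hw => hw.1

theorem ncard_children (hG : IsHomogeneousTree G q) (v : V) :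
    (children G o v).ncard = if G.dist o v = 0 then q + 1 else q := by
  have hfin : (G.neighborSet v).Finite :=
    Set.finite_of_ncard_ne_zero (by rw [hG.ncard_neighborSet]; omega)
  split_ifs with h
  · rw [← hG.ncard_neighborSet v]
    congr 1
    ext w
    refine ⟨fun hw => hw.1, fun hw => ⟨hw, ?_⟩⟩
    rcases hG.isTree.dist_eq_dist_add_one_of_adj o (show G.Adj v w from hw) with h1 | h1 <;> omega
  · obtain ⟨n, hn⟩ := Nat.exists_eq_succ_of_ne_zero h
    obtain ⟨u, hu, hun⟩ := exists_parent hG.isTree.connected hn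
    have e : children G o v = G.neighborSet v \ {u} := by
      ext w
      constructor
      · rintro ⟨h1, h2⟩
        refine ⟨h1, ?_⟩
        rintro rfl
        omega
      · rintro ⟨h1, h2⟩
        refine ⟨h1, ?_⟩
        rcases hG.isTree.dist_eq_dist_add_one_of_adj o (show G.Adj v w from h1) with h3 | h3
        · exact absurd (parent_unique (o := o) hG.isTree (SimpleGraph.Adj.symm h1) hu h3 (by omega)) h2
        · exact h3
    rw [e, Set.ncard_sdiff_singleton_of_mem (show u ∈ G.neighborSet v from SimpleGraph.Adj.symm hu),
      hG.ncard_neighborSet]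
    rfl

theorem sphereWeight_succ (hq : 2 ≤ q) (n : ℕ) :
    sphereWeight q (n + 1) =
      (((if n = 0 then q + 1 else q : ℕ) : ℝ≥0∞))⁻¹ * sphereWeight q n := by
  rcases n with _ | n
  · simp [sphereWeight]
  · have hq0 : (q : ℝ≥0∞) ≠ 0 := by simp; omega
    simp only [sphereWeight, Nat.add_eq_zero_iff, one_ne_zero, and_false, if_false,
      Nat.add_sub_cancel]
    rw [← ENNReal.mul_inv (Or.inl hq0) (Or.inl (by simp))]
    congr 1
    ring

/-- The ray from `o` whose successive vertices are given by a choice of a child of each vertex. -/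
def ofChoice (hG : G.Connected) (y : ∀ v, children G o v) : TreeBoundary G o :=
  have hd : ∀ n, G.dist o (Nat.rec o (fun _ v => (y v).1) n : V) = n := by
    intro n
    induction n with
    | zero => simp
    | succ n ih => exact (y _).2.2.trans (by rw [ih])
  have ha : ∀ n, G.Adj (Nat.rec o (fun _ v => (y v).1) n : V)
      (Nat.rec o (fun _ v => (y v).1) (n + 1) : V) := fun n => (y _).2.1
  { vertex := fun n => Nat.rec o (fun _ v => (y v).1) n
    vertex_zero := rfl
    adj := ha
    geodesic := by
      intro m k
      refine le_antisymm ?_ ?_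
      · induction k with
        | zero => simp
        | succ k ih =>
          refine hG.dist_triangle.trans (add_le_add ih ?_)
          exact (SimpleGraph.dist_eq_one_iff_adj.2 (ha (m + k))).le
      · have h := hG.dist_triangle (u := o) (v := (Nat.rec o (fun _ v => (y v).1) m : V))
          (w := (Nat.rec o (fun _ v => (y v).1) (m + k) : V))
        rw [hd, hd] at h
        omega }

theorem setOf_ofChoice_eq (hG : IsHomogeneousTree G q) [∀ v, MeasurableSpace (children G o v)]
    (μ : ∀ v, Measure (children G o v))
    (hμ : ∀ v w, μ v {w} = (((children G o v).ncard : ℕ) : ℝ≥0∞)⁻¹) (n : ℕ) :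
    ∀ x, G.dist o x = n → ∃ (s : Finset V) (t : ∀ v, Set (children G o v)),
      (∀ v ∈ s, G.dist o v < n) ∧
      {y | (ofChoice hG.isTree.connected y).vertex n = x} = Set.pi s t ∧
      ∏ v ∈ s, μ v (t v) = sphereWeight q n := by
  classical
  induction n with
  | zero =>
    intro x hx
    obtain rfl : o = x := hG.isTree.connected.dist_eq_zero_iff.1 hx
    refine ⟨∅, fun _ => Set.univ, by simp, ?_, by simp [sphereWeight]⟩
    ext y
    simp [(ofChoice hG.isTree.connected y).vertex_zero]
  | succ n ih =>
    intro x hx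
    obtain ⟨u, hu, hun⟩ := exists_parent hG.isTree.connected hx
    obtain ⟨s, t, hs, hst, hprod⟩ := ih u hun
    have hus : u ∉ s := fun h => by have := hs u h; omega
    let c : children G o u := ⟨x, hu, by omega⟩
    refine ⟨insert u s, Function.update t u {c}, ?_, ?_, ?_⟩
    · intro v hv
      rcases Finset.mem_insert.1 hv with rfl | hv
      · omega
      · have := hs v hv; omega
    · have e : (((insert u s : Finset V) : Set V).pi (Function.update t u {c})) =
          {y | y u = c} ∩ Set.pi s t := by
        rw [Finset.coe_insert, Set.insert_pi]
        congr 1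
        · ext y; simp
        · refine Set.pi_congr rfl fun v hv => ?_
          rw [Function.update_of_ne]
          rintro rfl
          exact hus hv
      rw [e, ← hst]
      ext y
      have hstep : (ofChoice hG.isTree.connected y).vertex (n + 1) =
        (y ((ofChoice hG.isTree.connected y).vertex n)).1 := rfl
      simp only [Set.mem_ofPred_eq, Set.mem_inter_iff]
      constructor
      · intro h
        have hv : (ofChoice hG.isTree.connected y).vertex n = u := by
          have a := (ofChoice hG.isTree.connected y).adj n
          rw [h] at a
          refine parent_unique (o := o) hG.isTree a hu ?_ (by omega)
          rw [dist_vertex, hx]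
        refine ⟨?_, hv⟩
        rw [hstep, hv] at h
        exact Subtype.ext h
      · rintro ⟨h1, h2⟩
        rw [hstep, h2, h1]
    · rw [Finset.prod_insert hus, Function.update_self, hμ, ncard_children hG,
        sphereWeight_succ hG.two_le, ← hprod, hun]
      congr 1
      refine Finset.prod_congr rfl fun v hv => ?_
      rw [Function.update_of_ne]
      rintro rfl
      exact hus hv

/-- There is exactly one measure on `Ω` with `ν(E(x)) = 1` if `x = o` and
`ν(E(x)) = 1 / ((q + 1) q ^ (|x| - 1))` otherwise. -/
theorem existsUnique_measure (hG : IsHomogeneousTree G q) (o : V) :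
    ∃! ν : Measure (TreeBoundary G o), ∀ x, ν (sector G o x) = sphereWeight q (G.dist o x) := by
  classical
  have hc := hG.isTree.connected
  have huniv : ∀ ν : Measure (TreeBoundary G o),
      (∀ x, ν (sector G o x) = sphereWeight q (G.dist o x)) → ν Set.univ = 1 := by
    intro ν hν
    have := hν o
    rwa [sector_self hc, SimpleGraph.dist_self, sphereWeight, if_pos rfl] at this
  refine existsUnique_of_exists_of_unique ?_ ?_
  · let : ∀ v, Fintype (children G o v) := fun v => (finite_children hG v).fintype
    let : ∀ v, MeasurableSpace (children G o v) := fun v => ⊤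
    have : ∀ v, Nonempty (children G o v) := fun v => by
      have h : (children G o v).ncard ≠ 0 := by
        rw [ncard_children hG]
        have := hG.two_le
        split_ifs <;> omega
      exact (Set.nonempty_of_ncard_ne_zero h).to_subtype
    let μ : ∀ v, Measure (children G o v) := fun v => (PMF.uniformOfFintype _).toMeasure
    have hμ : ∀ v w, μ v {w} = (((children G o v).ncard : ℕ) : ℝ≥0∞)⁻¹ := by
      intro v w
      rw [PMF.toMeasure_apply_singleton _ _ (MeasurableSet.of_discrete),
        PMF.uniformOfFintype_apply, Set.ncard_eq_toFinset_card', Set.toFinset_card]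
    have hpre : ∀ x, ∃ (s : Finset V) (t : ∀ v, Set (children G o v)),
        (ofChoice hc) ⁻¹' (sector G o x) = Set.pi s t ∧
        ∏ v ∈ s, μ v (t v) = sphereWeight q (G.dist o x) := by
      intro x
      obtain ⟨s, t, -, hst, hp⟩ := setOf_ofChoice_eq hG μ hμ _ x rfl
      refine ⟨s, t, ?_, hp⟩
      rw [← hst]
      ext y
      exact mem_sector_iff hc x _
    have hmeas : Measurable (ofChoice (G := G) (o := o) hc) := by
      refine measurable_generateFrom ?_
      rintro _ ⟨x, rfl⟩
      obtain ⟨s, t, hst, -⟩ := hpre x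
      rw [hst]
      exact MeasurableSet.pi s.countable_toSet fun v _ => MeasurableSet.of_discrete
    refine ⟨(Measure.infinitePi μ).map (ofChoice hc), fun x => ?_⟩
    obtain ⟨s, t, hst, hp⟩ := hpre x
    rw [Measure.map_apply hmeas (MeasurableSpace.measurableSet_generateFrom ⟨x, rfl⟩), hst,
      Measure.infinitePi_pi _ fun v _ => MeasurableSet.of_discrete, hp]
  · intro ν ν' hν hν'
    have : IsFiniteMeasure ν := ⟨by rw [huniv ν hν]; simp⟩
    refine ext_of_generate_finite _ rfl (isPiSystem_sector hG.isTree) ?_ ?_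
    · rintro _ ⟨x, rfl⟩
      rw [hν, hν']
    · rw [huniv ν hν, huniv ν' hν']

/-- The probability measure `ν` on `Ω`, determined by its values on the sectors. -/
noncomputable def measure (hG : IsHomogeneousTree G q) (o : V) : Measure (TreeBoundary G o) :=
  (existsUnique_measure hG o).choose

theorem measure_sector (hG : IsHomogeneousTree G q) (o x : V) :
    measure hG o (sector G o x) = sphereWeight q (G.dist o x) :=
  (existsUnique_measure hG o).choose_spec.1 x

/-- The Poisson kernel `p(x, ω) = q ^ (2 |c(x, ω)| - |x|)`. -/
noncomputable def poissonKernel (q : ℕ) (x : V) (ω : TreeBoundary G o) : ℝ :=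
  (q : ℝ) ^ (2 * (G.dist o (confluence x ω) : ℤ) - (G.dist o x : ℤ))

/-- The Poisson transform `𝒫_z F(x) = ∫ p(x, ω) ^ (1/2 + i z) F(ω) dν(ω)`. -/
noncomputable def poissonTransform (hG : IsHomogeneousTree G q) (o : V) (z : ℂ)
    (F : TreeBoundary G o → ℂ) (x : V) : ℂ :=
  ∫ ω, (poissonKernel q x ω : ℂ) ^ (1 / 2 + Complex.I * z) * F ω ∂(measure hG o)

/-- The elementary spherical function `φ_z = 𝒫_z 1`. -/
noncomputable def sphericalFunction (hG : IsHomogeneousTree G q) (o : V) (z : ℂ) (x : V) : ℂ :=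
  poissonTransform hG o z (fun _ => 1) x

/-- `δ_p = 1/p - 1/2`; for the conjugate exponent `p'` one has `δ_{p'} = -δ_p`. -/
noncomputable def hardyDelta (p : ℝ) : ℝ := 1 / p - 1 / 2

/-- `(∫_K |u(k · x)|^r dk)^{1/r}` for `|x| = n` and `r < ∞`: the `L^r` mean of `u` over the sphere
`S(o, n)`, as `∫_K v(k · x) dk` is the average of `v` over that sphere. -/
noncomputable def sphericalMean (G : SimpleGraph V) (q : ℕ) (o : V) (r : ℝ) (u : V → ℂ) (n : ℕ) :
    ℝ≥0∞ :=
  (sphereWeight q n * ∑' y : {y : V // G.dist o y = n}, ‖u y‖ₑ ^ r) ^ (1 / r)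

/-- The Hardy-type norm `‖u‖_{ℋ^r_p(𝒳)}`, with values in `[0, ∞]`. The spherical function
`φ_{iδ_p}` is positive and radial; `φ_{iδ_p}(n)` is its value at the `n`-th vertex of the fixed
reference ray `ω₀`. -/
noncomputable def hardyNorm (hG : IsHomogeneousTree G q) (o : V) (ω₀ : TreeBoundary G o)
    (p : ℝ) (r : ℝ≥0∞) (u : V → ℂ) : ℝ≥0∞ :=
  if r = ∞ then
    ⨆ x : V, ‖sphericalFunction hG o (Complex.I * hardyDelta p) x‖ₑ⁻¹ * ‖u x‖ₑ
  else
    ⨆ n : ℕ, ‖sphericalFunction hG o (Complex.I * hardyDelta p) (ω₀.vertex n)‖ₑ⁻¹ *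
      sphericalMean G q o r.toReal u n

end TreeBoundary

namespace TreeBoundary

open Filter Topology

/-! ### Rays, their confluence, and the measurable structure of the boundary -/

section Rays

variable {V : Type*} {G : SimpleGraph V} {o : V} {q : ℕ}

/-! Everything is moved to `Ω`: a function `u` on the sphere of radius `n` becomes `ω ↦ u(ω_n)`, and
since the law of `ω_n` is uniform on the sphere, spherical means become `L^r(Ω)` norms
(`hardyNorm_eq_iSup`). The kernel at `ω_n` depends on `ω'` only through the level where the rays
separate, so Abel summation over levels turns the Poisson transform into a weighted sum of the
martingale `E_j F`, `E_j` being conditional expectation on the first `j` steps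
(`integral_poissonKernel_mul`). With `s = 1/2 + iz = 1/p + iα`, `Q = q^s` and `a = Q²/q`, `𝒫_z
F(ω_n) = Q⁻ⁿ (E_0 F + (qa - 1)/(q + 1) Σ_{i<n} aⁱ E_{i+1} F)`. The weights in the bracket add up to
`D_n(a) = sphericalSum q a n`, and `φ_{iδ_p}(n) = |Q|⁻ⁿ D_n(|a|)`.

Upper bound: pass to `|F|` and `Re s`, so that all weights are nonnegative; then use Minkowski and
the contractivity of `E_j` on `L^r`.

Lower bound: by Lévy's theorem `E_j F → F` a.e. If `|D_n(a)| ≥ C D_n(|a|)` eventually, the weighted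
means of the martingale also tend to `F` a.e., that is, `Qⁿ 𝒫_z F(ω_n) / D_n(a) → F(ω)`, and Fatou
gives `C ‖F‖ ≤ ‖𝒫_z F‖`. Maximal functions and duality are avoided, so all `r` in `[1, ∞]` are
treated alike.

What remains is the estimate on `D_n(a)` (`exists_eventually_le_norm_sphericalSum`). For `p < 2` the
geometric sum has ratio `|a| = q^(2/p-1) ≥ 2^(2/p-1) > 1` and its top term dominates, uniformly in
`q` and `α`; for `p = 2` the condition on `α` means `a = 1`. -/

theorem eq_vertex_of_dist_add_dist (hG : G.IsTree) (ω : TreeBoundary G o) {x : V} :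
    ∀ {n : ℕ}, G.dist o x + G.dist x (ω.vertex n) = n → x = ω.vertex (G.dist o x) := by
  intro n
  obtain ⟨k, hk⟩ : ∃ k, G.dist x (ω.vertex n) = k := ⟨_, rfl⟩
  induction k generalizing n with
  | zero =>
    intro h
    have h2 : G.dist o x = n := by omega
    rw [h2]
    exact hG.connected.dist_eq_zero_iff.1 hk
  | succ k ih =>
    intro h
    obtain ⟨m, rfl⟩ : ∃ m, n = m + 1 := ⟨n - 1, by omega⟩
    -- Here `x` serves as the root: `u` is the neighbour of `ω_{m+1}` one step closer to `x`. The
    -- distances force it to be the parent of `ω_{m+1}` as seen from `o`, so it is `ω_m`.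
    obtain ⟨u, hu, hxu⟩ := exists_parent hG.connected hk
    have h1 := hG.connected.dist_triangle (u := o) (v := x) (w := u)
    have h2 := hG.connected.dist_triangle (u := o) (v := u) (w := ω.vertex (m + 1))
    rw [SimpleGraph.dist_eq_one_iff_adj.2 hu, dist_vertex] at h2
    have hum : u = ω.vertex m :=
      parent_unique (o := o) hG hu (ω.adj m) (by rw [dist_vertex]; omega) (by simp [dist_vertex])
    subst hum
    exact ih hxu (by omega)

theorem dist_confluence_vertex_le (ω ω' : TreeBoundary G o) (n : ℕ) :
    G.dist o (confluence (ω.vertex n) ω') ≤ n := by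
  unfold confluence
  rw [dist_vertex]
  refine csSup_le ⟨0, by simp [ω'.vertex_zero]⟩ fun j hj => ?_
  simp only [Set.mem_ofPred_eq, dist_vertex] at hj
  omega

/-- Two rays agree up to level `i` iff their confluence has level at least `i`. -/
theorem le_dist_confluence_vertex_iff (hG : G.IsTree) (ω ω' : TreeBoundary G o) {i n : ℕ}
    (hi : i ≤ n) :
    i ≤ G.dist o (confluence (ω.vertex n) ω') ↔ ω'.vertex i = ω.vertex i := by
  unfold confluence
  rw [dist_vertex]
  set S : Set ℕ := {j : ℕ | G.dist o (ω'.vertex j) + G.dist (ω'.vertex j) (ω.vertex n)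
    = G.dist o (ω.vertex n)} with hS
  have hb : BddAbove S := ⟨n, fun j hj => by
    simp only [hS, Set.mem_ofPred_eq, dist_vertex] at hj
    omega⟩
  have hmem : sSup S ∈ S := Nat.sSup_mem ⟨0, by simp [hS, ω'.vertex_zero]⟩ hb
  constructor
  · intro h
    have h1 := eq_vertex_of_dist_add_dist hG ω (x := ω'.vertex (sSup S)) (n := n)
      (hmem.trans (dist_vertex ω n))
    rw [dist_vertex] at h1
    exact vertex_eq_of_le hG h1 h
  · intro h
    refine le_csSup hb ?_
    obtain ⟨k, rfl⟩ := Nat.exists_eq_add_of_le hi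
    simp only [hS, Set.mem_ofPred_eq, h, ω.geodesic, dist_vertex]

theorem setOf_vertex_eq (hG : G.Connected) {x : V} {n : ℕ} (hx : G.dist o x = n) :
    {ω : TreeBoundary G o | ω.vertex n = x} = sector G o x := by
  ext ω
  rw [mem_sector_iff hG, hx]
  rfl

theorem finite_sphere (hG : IsHomogeneousTree G q) (o : V) (n : ℕ) :
    {x | G.dist o x = n}.Finite := by
  induction n with
  | zero =>
    refine (Set.finite_singleton o).subset fun x hx => ?_
    exact (hG.isTree.connected.dist_eq_zero_iff.1 hx).symm
  | succ n ih =>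
    refine (ih.biUnion fun v _ => finite_children (o := o) hG v).subset fun x hx => ?_
    obtain ⟨u, hu, hun⟩ := exists_parent hG.isTree.connected hx
    exact Set.mem_biUnion hun ⟨hu, by rw [hun]; exact hx⟩

theorem countable_vertices (hG : IsHomogeneousTree G q) (o : V) : Countable V := by
  rw [← Set.countable_univ_iff]
  refine (Set.countable_iUnion fun n => (finite_sphere hG o n).countable).mono fun x _ => ?_
  exact Set.mem_iUnion.2 ⟨G.dist o x, rfl⟩

theorem measurableSet_sector (x : V) : MeasurableSet (sector G o x) :=
  MeasurableSpace.measurableSet_generateFrom ⟨x, rfl⟩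

theorem measurableSet_setOf_vertex_eq (hG : G.Connected) (n : ℕ) (x : V) :
    MeasurableSet {ω : TreeBoundary G o | ω.vertex n = x} := by
  by_cases hx : G.dist o x = n
  · rw [setOf_vertex_eq hG hx]
    exact measurableSet_sector x
  · convert MeasurableSet.empty using 1
    ext ω
    simp only [Set.mem_ofPred_eq, Set.mem_empty_iff_false, iff_false]
    rintro rfl
    exact hx (dist_vertex ω n)

theorem measurable_vertex (hG : IsHomogeneousTree G q) (n : ℕ) :
    Measurable[_, ⊤] fun ω : TreeBoundary G o => ω.vertex n := by
  have := countable_vertices hG o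
  let _ : MeasurableSpace V := ⊤
  exact measurable_to_countable' fun x => measurableSet_setOf_vertex_eq hG.isTree.connected n x

/-! ### The martingale of conditional expectations -/

/-- The filtration of `Ω` whose `n`-th σ-algebra is generated by the sectors of level `n`. -/
def vertexFiltration (hG : IsHomogeneousTree G q) (o : V) :
    Filtration ℕ (inferInstance : MeasurableSpace (TreeBoundary G o)) where
  seq n := MeasurableSpace.comap (fun ω => ω.vertex n) ⊤
  mono' := by
    rintro i j hij _ ⟨s, -, rfl⟩
    -- `ω_j` determines `ω_i` for `i ≤ j`, so an event about `ω_i` is the event that `ω_j` lies in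
    -- its set of possible values.
    refine ⟨(fun ω : TreeBoundary G o => ω.vertex j) '' ((fun ω => ω.vertex i) ⁻¹' s), trivial, ?_⟩
    ext ω
    constructor
    · rintro ⟨ω', h1, h2⟩
      have h3 : ω'.vertex i = ω.vertex i := vertex_eq_of_le hG.isTree h2 hij
      simpa [h3] using h1
    · exact fun h => ⟨ω, h, rfl⟩
  le' n := (measurable_vertex hG n).comap_le

theorem iSup_vertexFiltration (hG : IsHomogeneousTree G q) (o : V) :
    ⨆ n, vertexFiltration hG o n = (inferInstance : MeasurableSpace (TreeBoundary G o)) := by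
  refine le_antisymm (iSup_le fun n => (vertexFiltration hG o).le n) ?_
  refine MeasurableSpace.generateFrom_le ?_
  rintro _ ⟨x, rfl⟩
  refine le_iSup (fun n => vertexFiltration hG o n) (G.dist o x) _ ?_
  refine ⟨{x}, trivial, ?_⟩
  rw [← setOf_vertex_eq hG.isTree.connected rfl]
  rfl

instance isProbabilityMeasure_measure (hG : IsHomogeneousTree G q) (o : V) :
    IsProbabilityMeasure (measure hG o) := by
  refine ⟨?_⟩
  have h := measure_sector hG o o
  rwa [sector_self hG.isTree.connected, SimpleGraph.dist_self, sphereWeight, if_pos rfl] at h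

theorem measure_setOf_vertex_eq (hG : IsHomogeneousTree G q) {x : V} {n : ℕ}
    (hx : G.dist o x = n) :
    measure hG o {ω | ω.vertex n = x} = sphereWeight q n := by
  rw [setOf_vertex_eq hG.isTree.connected hx, measure_sector, hx]

theorem sphereWeight_ne_zero (q n : ℕ) : sphereWeight q n ≠ 0 := by
  unfold sphereWeight
  split_ifs
  · simp
  · exact ENNReal.inv_ne_zero.2 (by finiteness)

/-- The integral over a sector of level `n` is given by the conditional expectation. -/
theorem setIntegral_eq_condExp {E : Type*} [NormedAddCommGroup E] [NormedSpace ℝ E]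
    [CompleteSpace E]
    (hG : IsHomogeneousTree G q) (n : ℕ) {F : TreeBoundary G o → E}
    (hF : Integrable F (measure hG o)) (ω : TreeBoundary G o) :
    ∫ ω' in {ω' | ω'.vertex n = ω.vertex n}, F ω' ∂(measure hG o) =
      (sphereWeight q n).toReal • ((measure hG o)[F | vertexFiltration hG o n]) ω := by
  have hset : MeasurableSet[vertexFiltration hG o n] {ω' | ω'.vertex n = ω.vertex n} :=
    ⟨{ω.vertex n}, trivial, rfl⟩
  have hmeas := measurableSet_setOf_vertex_eq (o := o) hG.isTree.connected n (ω.vertex n)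
  rw [← setIntegral_condExp ((vertexFiltration hG o).le n) hF hset]
  set g := (measure hG o)[F | vertexFiltration hG o n] with hg
  have hgm : StronglyMeasurable[vertexFiltration hG o n] g := stronglyMeasurable_condExp
  -- Sectors of level `n` are atoms of the `n`-th σ-algebra: the level set of `g` through `ω` is a
  -- preimage under `ω ↦ ω_n`.
  have hconst : ∀ ω' ∈ {ω' : TreeBoundary G o | ω'.vertex n = ω.vertex n}, g ω' = g ω := by
    intro ω' h
    have := hgm.measurableSet_eq_fun (g := fun _ => g ω) stronglyMeasurable_const
    obtain ⟨s, -, hs⟩ := this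
    have h1 : ω ∈ {x | g x = g ω} := rfl
    rw [← hs] at h1
    have h2 : ω' ∈ (fun ω : TreeBoundary G o => ω.vertex n) ⁻¹' s := by
      have h3 : ω'.vertex n = ω.vertex n := h
      simpa [h3] using h1
    rw [hs] at h2
    exact h2
  rw [setIntegral_congr_fun hmeas hconst, setIntegral_const, Measure.real,
    measure_setOf_vertex_eq hG (dist_vertex ω n)]

/-- Lévy's upward theorem on the boundary of the tree. -/
theorem tendsto_ae_condExp_vertexFiltration (hG : IsHomogeneousTree G q)
    {F : TreeBoundary G o → ℂ} (hF : Integrable F (measure hG o)) :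
    ∀ᵐ ω ∂(measure hG o), Tendsto
      (fun n => ((measure hG o)[F | vertexFiltration hG o n]) ω) atTop (𝓝 (F ω)) := by
  have key : ∀ g : TreeBoundary G o → ℝ, Integrable g (measure hG o) →
      ∀ᵐ ω ∂(measure hG o), Tendsto
        (fun n => ((measure hG o)[g | vertexFiltration hG o n]) ω) atTop (𝓝 (g ω)) := by
    intro g hg
    have h1 : (measure hG o)[g | ⨆ n, vertexFiltration hG o n] =ᵐ[measure hG o] g := by
      rw [iSup_vertexFiltration]
      exact condExp_of_aestronglyMeasurable' le_rfl hg.aestronglyMeasurable hg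
    filter_upwards [tendsto_ae_condExp (μ := measure hG o) (ℱ := vertexFiltration hG o) g, h1]
      with ω h2 h3
    rwa [h3] at h2
  have hcomm : ∀ T : ℂ →L[ℝ] ℝ, ∀ᵐ ω ∂(measure hG o), Tendsto
      (fun n => T (((measure hG o)[F | vertexFiltration hG o n]) ω)) atTop (𝓝 (T (F ω))) := by
    intro T
    have h := ae_all_iff.2 fun n =>
      T.comp_condExp_comm (m := vertexFiltration hG o n) hF
    filter_upwards [h, key _ (T.integrable_comp hF)] with ω h1 h2
    exact h2.congr fun n => (h1 n).symm
  filter_upwards [hcomm Complex.reCLM, hcomm Complex.imCLM] with ω h1 h2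
  have h3 := ((Complex.continuous_ofReal.tendsto _).comp h1).add
    (((Complex.continuous_ofReal.tendsto _).comp h2).mul_const Complex.I)
  simpa [Function.comp_def, Complex.re_add_im] using h3

theorem toReal_sphereWeight_succ (q n : ℕ) :
    (sphereWeight q (n + 1)).toReal = (((q : ℝ) + 1) * (q : ℝ) ^ n)⁻¹ := by
  rw [sphereWeight, if_neg (Nat.succ_ne_zero n), ENNReal.toReal_inv, ENNReal.toReal_mul,
    ENNReal.toReal_pow, ENNReal.toReal_add (by simp) (by simp)]
  simp

/-! ### Expansion of the Poisson transform along the martingale -/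

/-- Abel summation of a kernel that depends on the level of the confluence only. -/
theorem integral_dist_confluence_mul (hG : IsHomogeneousTree G q) (κ : ℕ → ℂ)
    {F : TreeBoundary G o → ℂ} (hF : Integrable F (measure hG o)) (ω : TreeBoundary G o) (n : ℕ) :
    ∫ ω', κ (G.dist o (confluence (ω.vertex n) ω')) * F ω' ∂(measure hG o) =
      κ 0 * ((measure hG o)[F | vertexFiltration hG o 0]) ω +
        ∑ i ∈ Finset.range n, (κ (i + 1) - κ i) * (((q : ℂ) + 1) * (q : ℂ) ^ i)⁻¹ *
          ((measure hG o)[F | vertexFiltration hG o (i + 1)]) ω := by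
  set S : ℕ → Set (TreeBoundary G o) := fun j => {ω' | ω'.vertex j = ω.vertex j} with hS
  have hSm : ∀ j, MeasurableSet (S j) := fun j =>
    measurableSet_setOf_vertex_eq hG.isTree.connected j _
  -- Telescoping of `κ` from `0` to the confluence level `c`; the increment from `i` to `i + 1`
  -- occurs iff `i + 1 ≤ c`, that is, iff `ω'` shares the vertex of level `i + 1` with `ω`.
  have hpt : ∀ ω', κ (G.dist o (confluence (ω.vertex n) ω')) * F ω' =
      κ 0 * F ω' + ∑ i ∈ Finset.range n, (κ (i + 1) - κ i) * (S (i + 1)).indicator F ω' := by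
    intro ω'
    set c := G.dist o (confluence (ω.vertex n) ω') with hc
    have hcn : c ≤ n := dist_confluence_vertex_le ω ω' n
    have hterm : ∀ i ∈ Finset.range n, (κ (i + 1) - κ i) * (S (i + 1)).indicator F ω' =
        if i ∈ Finset.range c then (κ (i + 1) - κ i) * F ω' else 0 := by
      intro i hi
      have := le_dist_confluence_vertex_iff hG.isTree ω ω' (i := i + 1) (n := n)
        (by have := Finset.mem_range.1 hi; omega)
      by_cases h : i < c
      · rw [if_pos (Finset.mem_range.2 h), Set.indicator_of_mem]
        exact this.1 h
      · rw [if_neg (by simpa using h), Set.indicator_of_notMem, mul_zero]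
        exact fun h' => h (this.2 h')
    rw [Finset.sum_congr rfl hterm, Finset.sum_ite_mem, Finset.inter_eq_right.2
      (Finset.range_mono hcn), ← Finset.sum_mul, Finset.sum_range_sub]
    ring
  have hint : ∀ j, ∫ ω', (S j).indicator F ω' ∂(measure hG o) =
      (sphereWeight q j).toReal • ((measure hG o)[F | vertexFiltration hG o j]) ω := by
    intro j
    rw [integral_indicator (hSm j)]
    exact setIntegral_eq_condExp hG j hF ω
  have h0 : ∫ ω', F ω' ∂(measure hG o) =
      ((measure hG o)[F | vertexFiltration hG o 0]) ω := by
    have h := hint 0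
    have hS0 : S 0 = Set.univ := by
      ext ω'
      simp [hS, TreeBoundary.vertex_zero]
    simpa [hS0, sphereWeight] using h
  simp_rw [hpt]
  rw [integral_add (hF.const_mul _) (integrable_finsetSum _ fun i _ =>
    ((hF.indicator (hSm _)).const_mul _)), integral_finsetSum _ fun i _ =>
    ((hF.indicator (hSm _)).const_mul _)]
  simp_rw [integral_const_mul]
  rw [h0]
  congr 1
  refine Finset.sum_congr rfl fun i _ => ?_
  rw [hint, toReal_sphereWeight_succ, Complex.real_smul, mul_assoc]
  push_cast
  rfl

/-- The base is an integer power of a positive real, with real logarithm, so the two exponents may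
be exchanged without a branch correction. -/
theorem poissonKernel_cpow (hq : 2 ≤ q) (s : ℂ) (x : V) (ω : TreeBoundary G o) :
    (poissonKernel q x ω : ℂ) ^ s =
      ((q : ℂ) ^ s) ^ (2 * (G.dist o (confluence x ω) : ℤ) - (G.dist o x : ℤ)) := by
  have hq0 : (0 : ℝ) < q := by positivity
  set k : ℤ := 2 * (G.dist o (confluence x ω) : ℤ) - (G.dist o x : ℤ) with hk
  rw [poissonKernel, ← hk, Complex.cpow_def_of_ne_zero (by exact_mod_cast (zpow_pos hq0 k).ne'),
    Complex.cpow_def_of_ne_zero (by exact_mod_cast hq0.ne'), ← Complex.ofReal_log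
    (zpow_pos hq0 k).le, Real.log_zpow, ← Complex.exp_int_mul]
  congr 1
  have : Complex.log (q : ℂ) = ((Real.log q : ℝ) : ℂ) := by
    rw [Complex.ofReal_log hq0.le]; simp
  rw [this]
  push_cast
  ring

/-- With `a = Q² / q`, the expansion of the Poisson transform into conditional expectations. -/
theorem integral_poissonKernel_mul (hG : IsHomogeneousTree G q) {s Q a : ℂ}
    (hQ : Q = (q : ℂ) ^ s) (ha : q * a = Q ^ 2)
    {F : TreeBoundary G o → ℂ} (hF : Integrable F (measure hG o)) (ω : TreeBoundary G o) (n : ℕ) :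
    ∫ ω', (poissonKernel q (ω.vertex n) ω' : ℂ) ^ s * F ω' ∂(measure hG o) =
      Q⁻¹ ^ n * (((measure hG o)[F | vertexFiltration hG o 0]) ω +
        (q * a - 1) / (q + 1) * ∑ i ∈ Finset.range n, a ^ i *
          ((measure hG o)[F | vertexFiltration hG o (i + 1)]) ω) := by
  have hq := hG.two_le
  have hq0 : (q : ℂ) ≠ 0 := by simp; omega
  have hq1 : (q : ℂ) + 1 ≠ 0 := by exact_mod_cast q.succ_ne_zero
  have hQ0 : Q ≠ 0 := by rw [hQ, Ne, Complex.cpow_eq_zero_iff]; tauto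
  have h := integral_dist_confluence_mul hG (fun j => Q ^ (2 * (j : ℤ) - (n : ℤ))) hF ω n
  simp_rw [poissonKernel_cpow hq, ← hQ, dist_vertex]
  -- The increments are thus `Q⁻ⁿ (qa)ⁱ (qa - 1)`, and the sector mass `1/((q + 1) qⁱ)` cancels
  -- `qⁱ`, leaving the weight `aⁱ`.
  have hk : ∀ j : ℕ, Q ^ (2 * (j : ℤ) - (n : ℤ)) = Q⁻¹ ^ n * (q * a) ^ j := by
    intro j
    rw [zpow_sub₀ hQ0, zpow_mul, zpow_natCast, zpow_natCast, inv_pow, ha, div_eq_inv_mul]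
    rfl
  rw [h, mul_add, Finset.mul_sum, Finset.mul_sum]
  congr 1
  · rw [hk]; simp
  · refine Finset.sum_congr rfl fun i _ => ?_
    simp only [hk]
    field_simp
    ring

end Rays
end TreeBoundary

namespace TreeBoundary

open Filter Topology

/-! ### Geometric sums behind the spherical functions, and regularity of the weighted means -/

section SphericalSum

/-- `1 + (q a - 1) / (q + 1) * (1 + a + ⋯ + a ^ (n - 1))`, the value of a spherical function on the
sphere of radius `n` up to normalization. -/
def sphericalSum {K : Type*} [Field K] (q : ℕ) (a : K) (n : ℕ) : K :=
  1 + (q * a - 1) / (q + 1) * ∑ i ∈ Finset.range n, a ^ i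

/-- This is the symmetry `φ_z = φ_{-z}`: since `a = q^{2iz}`, changing the sign of `z` inverts `a`.
It comes from reversing the geometric sum. -/
theorem sphericalSum_inv_mul_pow {K : Type*} [Field K] {q : ℕ} (hq : (q : K) + 1 ≠ 0) {a : K}
    (ha : a ≠ 0) (n : ℕ) : sphericalSum q a⁻¹ n * a ^ n = sphericalSum q a n := by
  have h : ∀ n, (∑ i ∈ Finset.range n, a⁻¹ ^ i) * a ^ n = a * ∑ i ∈ Finset.range n, a ^ i := by
    intro n
    induction n with
    | zero => simp
    | succ n ih =>
      have h1 : (a⁻¹) ^ n * a ^ n = 1 := by rw [← mul_pow, inv_mul_cancel₀ ha, one_pow]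
      rw [Finset.sum_range_succ, geom_sum_succ, add_mul, pow_succ, ← mul_assoc, ih,
        ← mul_assoc, h1]
      ring
  have hg := geom_sum_mul a n
  unfold sphericalSum
  rw [add_mul, mul_assoc, h]
  have : a ^ n = (∑ i ∈ Finset.range n, a ^ i) * (a - 1) + 1 := by rw [hg]; ring
  rw [this]
  field_simp
  ring

theorem mul_sphericalSum {K : Type*} [Field K] {q : ℕ} (hq : (q : K) + 1 ≠ 0) (a : K) (n : ℕ) :
    (q + 1) * (a - 1) * sphericalSum q a n = a ^ n * (q * a - 1) - (q - a) := by
  have hg := geom_sum_mul a n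
  unfold sphericalSum
  have : a ^ n = (∑ i ∈ Finset.range n, a ^ i) * (a - 1) + 1 := by rw [hg]; ring
  rw [this]
  field_simp
  ring

theorem sphericalSum_pos {q : ℕ} (hq : 2 ≤ q) {A : ℝ} (hA : 1 ≤ A) (n : ℕ) :
    0 < sphericalSum q A n := by
  have hq' : (2 : ℝ) ≤ q := by exact_mod_cast hq
  have : 0 ≤ (q * A - 1) / (q + 1) := div_nonneg (by nlinarith) (by positivity)
  unfold sphericalSum
  positivity

/-- By `mul_sphericalSum`, both sums are governed by `a^n (qa - 1)` for large `n`, up to the factors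
`a - 1` and `|a| - 1`. Their ratio costs `(|a| - 1)/(|a| + 1)`, increasing in `|a|`; the additional
`2` absorbs the bounded term `q - a`. -/
theorem eventually_le_norm_sphericalSum {q : ℕ} (hq : 2 ≤ q) {A₀ : ℝ} (hA₀ : 1 < A₀) {a : ℂ}
    (ha : A₀ ≤ ‖a‖) (haq : ‖a‖ ≤ q) :
    ∀ᶠ n in atTop, (A₀ - 1) / (2 * (A₀ + 1)) * sphericalSum q ‖a‖ n ≤ ‖sphericalSum q a n‖ := by
  set A := ‖a‖ with hA
  have hq' : (2 : ℝ) ≤ q := by exact_mod_cast hq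
  have hqA : 0 < q * A - 1 := by nlinarith
  have h1 : Tendsto (fun n : ℕ => A ^ n * (q * A - 1)) atTop atTop :=
    (tendsto_pow_atTop_atTop_of_one_lt (hA₀.trans_le ha)).atTop_mul_const hqA
  filter_upwards [h1.eventually_ge_atTop (2 * (q + A))] with n hn
  have hr := mul_sphericalSum (K := ℝ) (q := q) (by positivity) A n
  have hc := mul_sphericalSum (K := ℂ) (q := q) (by exact_mod_cast q.succ_ne_zero) a n
  have hDpos := sphericalSum_pos hq (hA₀.le.trans ha) n
  set D := sphericalSum q A n
  set D' := sphericalSum q a n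
  have e1 : ‖((q : ℂ) + 1) * (a - 1) * D'‖ ≤ (q + 1) * (A + 1) * ‖D'‖ := by
    rw [norm_mul, norm_mul]
    have : ‖(q : ℂ) + 1‖ = q + 1 := by
      have : (q : ℂ) + 1 = ((q + 1 : ℕ) : ℂ) := by push_cast; rfl
      rw [this, Complex.norm_natCast]; push_cast; rfl
    rw [this]
    gcongr
    exact (norm_sub_le _ _).trans (by simp [hA])
  have e2 : A ^ n * (q * A - 1) - (q + A) ≤ ‖a ^ n * ((q : ℂ) * a - 1) - (q - a)‖ := by
    have h2 := norm_sub_norm_le (a ^ n * ((q : ℂ) * a - 1)) (q - a)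
    have h3 : ‖(q : ℂ) - a‖ ≤ q + A := (norm_sub_le _ _).trans (by simp [hA])
    have h4 : q * A - 1 ≤ ‖(q : ℂ) * a - 1‖ := by
      have := norm_sub_norm_le ((q : ℂ) * a) 1
      simpa [hA] using this
    have h5 : A ^ n * (q * A - 1) ≤ ‖a ^ n * ((q : ℂ) * a - 1)‖ := by
      rw [norm_mul, norm_pow]
      gcongr
    linarith
  rw [← hc] at e2
  -- By `hn`, `q + A` is at most half of the leading term. On the left, `q - A ≥ 0` is dropped,
  -- which is where `‖a‖ ≤ q` enters.
  have e3 : (q + 1) * ((A - 1) * D) ≤ (q + 1) * (2 * ((A + 1) * ‖D'‖)) := by linarith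
  have e4 : (A - 1) * D ≤ 2 * ((A + 1) * ‖D'‖) := le_of_mul_le_mul_left e3 (by positivity)
  have e5 : (A₀ - 1) / (2 * (A₀ + 1)) ≤ (A - 1) / (2 * (A + 1)) := by
    rw [div_le_div_iff₀ (by linarith) (by linarith)]
    nlinarith
  refine (mul_le_mul_of_nonneg_right e5 hDpos.le).trans ?_
  rw [div_mul_eq_mul_div, div_le_iff₀ (by linarith)]
  linarith

/-- A summability method with geometric weights is regular if its normalizing sums do not
degenerate. -/
theorem tendsto_weighted_sum_div_sphericalSum {q : ℕ} (hq : 2 ≤ q) {a : ℂ} (ha : 1 ≤ ‖a‖) {C : ℝ}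
    (hC : 0 < C) (h : ∀ᶠ n in atTop, C * sphericalSum q ‖a‖ n ≤ ‖sphericalSum q a n‖)
    {m : ℕ → ℂ} {l : ℂ} (hm : Tendsto m atTop (𝓝 l)) :
    Tendsto (fun n => (m 0 + (q * a - 1) / (q + 1) * ∑ i ∈ Finset.range n, a ^ i * m (i + 1)) /
      sphericalSum q a n) atTop (𝓝 l) := by
  have hq' : (2 : ℝ) ≤ q := by exact_mod_cast hq
  set S : ℕ → ℝ := fun n => ∑ i ∈ Finset.range n, ‖a‖ ^ i with hS
  have hSt : Tendsto S atTop atTop := by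
    refine tendsto_atTop_mono (fun n => ?_) tendsto_natCast_atTop_atTop
    have : ∑ i ∈ Finset.range n, (1 : ℝ) ≤ S n :=
      Finset.sum_le_sum fun i _ => one_le_pow₀ ha
    simpa using this
  set B : ℝ := (q * ‖a‖ - 1) / (q + 1) with hB
  have hBpos : 0 < B := div_pos (by nlinarith) (by positivity)
  -- Nondegeneracy in the form needed: an error that is small relative to the absolute weights is
  -- small relative to the normalizing sum.
  have hSO : S =O[atTop] sphericalSum q a := by
    refine Asymptotics.IsBigO.of_bound (C * B)⁻¹ ?_
    filter_upwards [h] with n hn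
    have hSn : 0 ≤ S n := Finset.sum_nonneg fun i _ => by positivity
    rw [Real.norm_of_nonneg hSn, inv_mul_eq_div, le_div_iff₀ (by positivity)]
    refine le_trans ?_ hn
    change S n * (C * B) ≤ C * (1 + B * S n)
    nlinarith
  have h0 : Tendsto (fun n => m (n + 1) - l) atTop (𝓝 0) := by
    simpa using ((tendsto_add_atTop_iff_nat 1).2 hm).sub_const l
  have ho : (fun n => ∑ i ∈ Finset.range n, a ^ i * (m (i + 1) - l)) =o[atTop] S := by
    refine Asymptotics.IsLittleO.sum_range ?_ (fun n => by positivity) hSt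
    have h1 : (fun n => a ^ n) =O[atTop] fun n => ‖a‖ ^ n :=
      Asymptotics.isBigO_of_le _ fun n => by simp
    simpa using h1.mul_isLittleO ((Asymptotics.isLittleO_one_iff ℝ).2 h0)
  -- The initial term is negligible because `S n ≥ n`, even when `‖a‖ = 1`.
  have hc : (fun _ : ℕ => m 0 - l) =o[atTop] S := by
    rw [Asymptotics.isLittleO_const_left]
    exact Or.inr (tendsto_norm_atTop_atTop.comp hSt)
  have hlim := ((hc.add (ho.const_mul_left ((q * a - 1) / (q + 1)))).trans_isBigO
    hSO).tendsto_div_nhds_zero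
  have hev : ∀ᶠ n in atTop, sphericalSum q a n ≠ 0 := by
    filter_upwards [h] with n hn hz
    rw [hz, norm_zero] at hn
    have := mul_pos hC (sphericalSum_pos hq ha n)
    linarith
  have hlim2 := hlim.add_const l
  rw [zero_add] at hlim2
  refine hlim2.congr' ?_
  filter_upwards [hev] with n hn
  rw [div_add' _ _ _ hn]
  congr 1
  simp only [mul_sub, Finset.sum_sub_distrib, ← Finset.sum_mul]
  unfold sphericalSum
  ring

end SphericalSum

/-! ### The Hardy norm as a supremum of `L^r(Ω)` norms -/

section HardyNorm

variable {V : Type*} {G : SimpleGraph V} {o : V} {q : ℕ}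

theorem sphericalFunction_vertex (hG : IsHomogeneousTree G q) {p : ℝ} (ω : TreeBoundary G o)
    (n : ℕ) :
    sphericalFunction hG o (Complex.I * hardyDelta p) (ω.vertex n) =
      ((((q : ℝ) ^ (1 / p))⁻¹ ^ n * sphericalSum q ((q : ℝ) ^ (2 / p - 1)) n : ℝ) : ℂ) := by
  have hq0 : (0 : ℝ) < q := by have := hG.two_le; positivity
  set R : ℝ := (q : ℝ) ^ (1 / p) with hR
  set A : ℝ := (q : ℝ) ^ (2 / p - 1) with hA
  have hR0 : 0 < R := Real.rpow_pos_of_pos hq0 _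
  have hA0 : 0 < A := Real.rpow_pos_of_pos hq0 _
  have hRA : q * A = R ^ 2 := by
    rw [hA, hR, ← Real.rpow_natCast, ← Real.rpow_mul hq0.le, Real.rpow_sub hq0, Real.rpow_one]
    field_simp
    ring_nf
  -- The exponent is `1 - 1/p`, not `1/p`, so the expansion has ratio `A⁻¹`; the symmetry under
  -- inversion brings it to ratio `A`.
  have hs : 1 / 2 + Complex.I * (Complex.I * hardyDelta p) = ((1 - 1 / p : ℝ) : ℂ) := by
    rw [← mul_assoc, Complex.I_mul_I, hardyDelta]
    push_cast
    ring
  have hQ : ((q / R : ℝ) : ℂ) = (q : ℂ) ^ ((1 - 1 / p : ℝ) : ℂ) := by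
    rw [← Complex.ofReal_natCast, ← Complex.ofReal_cpow hq0.le, Real.rpow_sub hq0, Real.rpow_one]
  have ha : (q : ℂ) * ((A⁻¹ : ℝ) : ℂ) = ((q / R : ℝ) : ℂ) ^ 2 := by
    norm_cast
    rw [div_pow, ← hRA]
    field_simp
  unfold sphericalFunction poissonTransform
  rw [hs, integral_poissonKernel_mul hG hQ ha (integrable_const _) ω n]
  simp_rw [condExp_const ((vertexFiltration hG o).le _)]
  rw [← sphericalSum_inv_mul_pow (by positivity) hA0.ne' n]
  have e : (q / R)⁻¹ ^ n = R⁻¹ ^ n * A ^ n := by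
    rw [← mul_pow]
    congr 1
    field_simp
    rw [← hRA]
  rw [mul_comm (sphericalSum _ _ _), ← mul_assoc, ← e]
  simp [sphericalSum]

theorem lintegral_vertex (hG : IsHomogeneousTree G q) (n : ℕ) (g : V → ℝ≥0∞) :
    ∫⁻ ω, g (ω.vertex n) ∂(measure hG o) =
      sphereWeight q n * ∑' y : {y : V // G.dist o y = n}, g y := by
  have := countable_vertices hG o
  let _ : MeasurableSpace V := ⊤
  rw [← lintegral_map (μ := measure hG o) (f := g) (Measurable.of_discrete) (measurable_vertex hG n),
    lintegral_countable', ← ENNReal.tsum_mul_left]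
  refine Eq.trans (tsum_congr fun y => ?_)
    (tsum_subtype {y | G.dist o y = n} (fun y => sphereWeight q n * g y)).symm
  rw [Measure.map_apply (measurable_vertex hG n) (MeasurableSet.of_discrete)]
  by_cases hy : G.dist o y = n
  · rw [Set.indicator_of_mem (s := {y | G.dist o y = n}) hy, mul_comm]
    congr 1
    exact measure_setOf_vertex_eq hG hy
  · rw [Set.indicator_of_notMem (s := {y | G.dist o y = n}) hy]
    convert mul_zero _
    convert measure_empty (μ := measure hG o)
    ext ω
    simp only [Set.mem_preimage, Set.mem_singleton_iff, Set.mem_empty_iff_false, iff_false]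
    rintro rfl
    exact hy (dist_vertex ω n)

/-- The `L^r` mean over a sphere is an `L^r` norm on the boundary. -/
theorem sphericalMean_eq_eLpNorm (hG : IsHomogeneousTree G q) {r : ℝ≥0∞} (hr0 : r ≠ 0)
    (hr : r ≠ ∞) (u : V → ℂ) (n : ℕ) :
    sphericalMean G q o r.toReal u n =
      eLpNorm (fun ω : TreeBoundary G o => u (ω.vertex n)) r (measure hG o) := by
  rw [eLpNorm_eq_lintegral_rpow_enorm_toReal hr0 hr, lintegral_vertex hG n fun x => ‖u x‖ₑ ^ r.toReal]
  rfl

/-- Each sector has positive measure, so an essential supremum over rays controls every vertex;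
needed for `r = ∞`. -/
theorem exists_vertex_eq_of_ae (hG : IsHomogeneousTree G q) (x : V) {P : TreeBoundary G o → Prop}
    (hP : ∀ᵐ ω ∂(measure hG o), P ω) : ∃ ω, P ω ∧ ω.vertex (G.dist o x) = x := by
  by_contra! h
  refine sphereWeight_ne_zero q (G.dist o x) ?_
  rw [← measure_setOf_vertex_eq hG rfl]
  exact measure_mono_null (fun ω hω hPω => h ω hPω hω) hP

theorem hardyNorm_eq_iSup (hG : IsHomogeneousTree G q) (ω₀ : TreeBoundary G o) {p : ℝ}
    (hp0 : 0 < p) (hp2 : p ≤ 2) {r : ℝ≥0∞} (hr : r ≠ 0) (u : V → ℂ) :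
    hardyNorm hG o ω₀ p r u = ⨆ n : ℕ,
      (ENNReal.ofReal (((q : ℝ) ^ (1 / p))⁻¹ ^ n * sphericalSum q ((q : ℝ) ^ (2 / p - 1)) n))⁻¹ *
        eLpNorm (fun ω : TreeBoundary G o => u (ω.vertex n)) r (measure hG o) := by
  have hq0 : (0 : ℝ) < q := by have := hG.two_le; positivity
  have hA : 1 ≤ (q : ℝ) ^ (2 / p - 1) := by
    refine Real.one_le_rpow (by exact_mod_cast (by have := hG.two_le; omega : 1 ≤ q)) ?_
    rw [sub_nonneg, le_div_iff₀ hp0]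
    linarith
  have hpos : ∀ n : ℕ, 0 <
      ((q : ℝ) ^ (1 / p))⁻¹ ^ n * sphericalSum q ((q : ℝ) ^ (2 / p - 1)) n := fun n =>
    mul_pos (pow_pos (inv_pos.2 (Real.rpow_pos_of_pos hq0 _)) _) (sphericalSum_pos hG.two_le hA n)
  have hφ : ∀ (ω : TreeBoundary G o) n,
      ‖sphericalFunction hG o (Complex.I * hardyDelta p) (ω.vertex n)‖ₑ =
        ENNReal.ofReal (((q : ℝ) ^ (1 / p))⁻¹ ^ n *
          sphericalSum q ((q : ℝ) ^ (2 / p - 1)) n) := by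
    intro ω n
    rw [sphericalFunction_vertex, ← ofReal_norm, Complex.norm_real, Real.norm_of_nonneg (hpos n).le]
  unfold hardyNorm
  split_ifs with h
  · subst h
    simp only [eLpNorm_exponent_top]
    refine le_antisymm (iSup_le fun x => ?_) (iSup_le fun n => ?_)
    · obtain ⟨ω, h1, h2⟩ := exists_vertex_eq_of_ae hG x (enorm_ae_le_eLpNormEssSup
        (fun ω : TreeBoundary G o => u (ω.vertex (G.dist o x))) (measure hG o))
      refine le_iSup_of_le (G.dist o x) ?_
      have h3 := hφ ω (G.dist o x)
      rw [h2] at h1 h3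
      rw [h3]
      gcongr
    · rw [ENNReal.inv_mul_le_iff (by simpa using hpos n) ENNReal.ofReal_ne_top]
      refine eLpNormEssSup_le_of_ae_enorm_bound (Eventually.of_forall fun ω => ?_)
      rw [← ENNReal.inv_mul_le_iff (by simpa using hpos n) ENNReal.ofReal_ne_top, ← hφ ω n]
      exact le_iSup (fun x => ‖sphericalFunction hG o (Complex.I * hardyDelta p) x‖ₑ⁻¹ * ‖u x‖ₑ)
        (ω.vertex n)
  · simp only [hφ, sphericalMean_eq_eLpNorm hG hr h]

end HardyNorm
end TreeBoundary

namespace TreeBoundary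

open Filter Topology

variable {V : Type*} {G : SimpleGraph V} {o : V} {q : ℕ}

/-! ### The upper bound -/

theorem norm_integral_poissonKernel_mul_le (hq : 2 ≤ q) (ν : Measure (TreeBoundary G o)) (s : ℂ)
    (x : V) (F : TreeBoundary G o → ℂ) :
    ‖∫ ω, (poissonKernel q x ω : ℂ) ^ s * F ω ∂ν‖ ≤
      ‖∫ ω, (poissonKernel q x ω : ℂ) ^ (s.re : ℂ) * ((‖F ω‖ : ℝ) : ℂ) ∂ν‖ := by
  have hpos : ∀ ω : TreeBoundary G o, 0 < poissonKernel q x ω := fun ω =>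
    zpow_pos (by positivity) _
  have h : ∀ ω : TreeBoundary G o, (poissonKernel q x ω : ℂ) ^ (s.re : ℂ) * ((‖F ω‖ : ℝ) : ℂ) =
      ((‖(poissonKernel q x ω : ℂ) ^ s * F ω‖ : ℝ) : ℂ) := by
    intro ω
    rw [norm_mul, Complex.norm_cpow_eq_rpow_re_of_pos (hpos ω), Complex.ofReal_mul,
      Complex.ofReal_cpow (hpos ω).le]
  simp_rw [h]
  rw [integral_complex_ofReal, Complex.norm_real]
  exact (norm_integral_le_integral_norm _).trans (le_abs_self _)

/-- The Poisson transform, restricted to spheres, is bounded by the spherical function. -/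
theorem eLpNorm_integral_poissonKernel_mul_le (hG : IsHomogeneousTree G q) {p : ℝ} (hp1 : 1 ≤ p)
    (hp2 : p ≤ 2) {s : ℂ} (hs : s.re = 1 / p) {r : ℝ≥0∞} (hr : 1 ≤ r) {F : TreeBoundary G o → ℂ}
    (hF : MemLp F r (measure hG o)) (n : ℕ) :
    eLpNorm (fun ω : TreeBoundary G o =>
        ∫ ω', (poissonKernel q (ω.vertex n) ω' : ℂ) ^ s * F ω' ∂(measure hG o)) r (measure hG o) ≤
      ENNReal.ofReal (((q : ℝ) ^ (1 / p))⁻¹ ^ n * sphericalSum q ((q : ℝ) ^ (2 / p - 1)) n) *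
        eLpNorm F r (measure hG o) := by
  have hq0 : (0 : ℝ) < q := by have := hG.two_le; positivity
  have hq1 : (1 : ℝ) ≤ q := by exact_mod_cast (by have := hG.two_le; omega : 1 ≤ q)
  set R : ℝ := (q : ℝ) ^ (1 / p) with hR
  set A : ℝ := (q : ℝ) ^ (2 / p - 1) with hA
  have hR0 : 0 < R := Real.rpow_pos_of_pos hq0 _
  have hA1 : 1 ≤ A := by
    refine Real.one_le_rpow hq1 ?_
    rw [sub_nonneg, le_div_iff₀ (by linarith)]
    linarith
  have hRA : q * A = R ^ 2 := by
    rw [hA, hR, ← Real.rpow_natCast, ← Real.rpow_mul hq0.le, Real.rpow_sub hq0, Real.rpow_one]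
    field_simp
    norm_num
  set B : ℝ := (q * A - 1) / (q + 1) with hB
  have hB0 : 0 ≤ B := div_nonneg (by nlinarith) (by positivity)
  have hQ : (R : ℂ) = (q : ℂ) ^ ((s.re : ℝ) : ℂ) := by
    rw [← Complex.ofReal_natCast, ← Complex.ofReal_cpow hq0.le, hs]
  have ha : (q : ℂ) * (A : ℂ) = (R : ℂ) ^ 2 := by exact_mod_cast hRA
  set f : TreeBoundary G o → ℂ := fun ω => ((‖F ω‖ : ℝ) : ℂ) with hf
  have hfint : Integrable f (measure hG o) := (hF.integrable hr).norm.ofReal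
  have hfF : eLpNorm f r (measure hG o) = eLpNorm F r (measure hG o) :=
    eLpNorm_congr_norm_ae (Eventually.of_forall fun ω => by simp [hf])
  set M : ℕ → TreeBoundary G o → ℂ := fun j => (measure hG o)[f | vertexFiltration hG o j] with hM
  have hMm : ∀ j, AEStronglyMeasurable (M j) (measure hG o) := fun j =>
    (stronglyMeasurable_condExp.mono ((vertexFiltration hG o).le j)).aestronglyMeasurable
  have hMle : ∀ j, eLpNorm (M j) r (measure hG o) ≤ eLpNorm F r (measure hG o) := fun j =>
    (eLpNorm_condExp_le_eLpNorm f hr).trans_eq hfF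
  -- After passing to `|F|` and the real exponent, the weights are nonnegative and add up to exactly
  -- `φ_{iδ_p}(n)`, so Minkowski yields constant `1`.
  have h1 : eLpNorm (fun ω : TreeBoundary G o =>
        ∫ ω', (poissonKernel q (ω.vertex n) ω' : ℂ) ^ s * F ω' ∂(measure hG o)) r (measure hG o) ≤
      eLpNorm (((R : ℂ)⁻¹ ^ n) • (M 0 + (B : ℂ) • ∑ i ∈ Finset.range n, ((A : ℂ) ^ i) • M (i + 1)))
        r (measure hG o) := by
    refine eLpNorm_mono fun ω => ?_
    refine (norm_integral_poissonKernel_mul_le hG.two_le _ s _ F).trans_eq ?_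
    rw [integral_poissonKernel_mul hG hQ ha hfint ω n]
    simp [hM, hB, Finset.sum_apply]
  refine h1.trans ?_
  set N := eLpNorm F r (measure hG o) with hN
  have hen : ∀ t : ℝ, 0 ≤ t → ‖(t : ℂ)‖ₑ = ENNReal.ofReal t := fun t ht => by
    rw [← ofReal_norm, Complex.norm_real, Real.norm_of_nonneg ht]
  have hsum : eLpNorm (∑ i ∈ Finset.range n, ((A : ℂ) ^ i) • M (i + 1)) r (measure hG o) ≤
      ENNReal.ofReal (∑ i ∈ Finset.range n, A ^ i) * N := by
    refine (eLpNorm_sum_le (fun i _ => (hMm _).const_smul _) hr).trans ?_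
    rw [ENNReal.ofReal_sum_of_nonneg fun i _ => by positivity, Finset.sum_mul]
    refine Finset.sum_le_sum fun i _ => ?_
    rw [eLpNorm_const_smul, ← Complex.ofReal_pow, hen _ (by positivity)]
    gcongr
    exact hMle _
  rw [eLpNorm_const_smul, ← Complex.ofReal_inv, ← Complex.ofReal_pow, hen _ (by positivity),
    ENNReal.ofReal_mul (by positivity), mul_assoc]
  gcongr
  refine (eLpNorm_add_le (hMm 0) ((Finset.aestronglyMeasurable_sum _ fun i _ =>
    (hMm _).const_smul _).const_smul _) hr).trans ?_
  rw [sphericalSum, ENNReal.ofReal_add zero_le_one (mul_nonneg hB0 (by positivity)), add_mul,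
    ENNReal.ofReal_one, one_mul, eLpNorm_const_smul, hen _ hB0, ENNReal.ofReal_mul hB0, mul_assoc]
  gcongr
  exact hMle 0

/-! ### The lower bound -/

/-- If the normalized spherical function `φ_z / φ_{iδ_p}` is eventually bounded below by `C`, then
so is the Poisson transform. -/
theorem le_hardyNorm_of_eventually_le (hG : IsHomogeneousTree G q) (ω₀ : TreeBoundary G o) {p : ℝ}
    (hp1 : 1 ≤ p) (hp2 : p ≤ 2) {s a : ℂ} (hs : s.re = 1 / p) (ha : q * a = ((q : ℂ) ^ s) ^ 2)
    (hnorm : ‖a‖ = (q : ℝ) ^ (2 / p - 1)) {C : ℝ} (hC : 0 < C)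
    (h : ∀ᶠ n in atTop, C * sphericalSum q ‖a‖ n ≤ ‖sphericalSum q a n‖)
    {r : ℝ≥0∞} (hr : 1 ≤ r) {F : TreeBoundary G o → ℂ} (hF : MemLp F r (measure hG o)) :
    ENNReal.ofReal C * eLpNorm F r (measure hG o) ≤ hardyNorm hG o ω₀ p r
      (fun x => ∫ ω', (poissonKernel q x ω' : ℂ) ^ s * F ω' ∂(measure hG o)) := by
  have hq0 : (0 : ℝ) < q := by have := hG.two_le; positivity
  have hq1 : (1 : ℝ) ≤ q := by exact_mod_cast (by have := hG.two_le; omega : 1 ≤ q)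
  have hA1 : 1 ≤ ‖a‖ := by
    rw [hnorm]
    refine Real.one_le_rpow hq1 ?_
    rw [sub_nonneg, le_div_iff₀ (by linarith)]
    linarith
  set Q : ℂ := (q : ℂ) ^ s with hQ
  have hQn : ‖Q‖ = (q : ℝ) ^ (1 / p) := by
    rw [hQ, ← Complex.ofReal_natCast, Complex.norm_cpow_eq_rpow_re_of_pos hq0, hs]
  have hQ0 : Q ≠ 0 := norm_ne_zero_iff.1 (by rw [hQn]; positivity)
  have hFint := hF.integrable hr
  set u : V → ℂ := fun x => ∫ ω', (poissonKernel q x ω' : ℂ) ^ s * F ω' ∂(measure hG o) with hu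
  set H := hardyNorm hG o ω₀ p r u with hH
  have hHn : ∀ n : ℕ, eLpNorm (fun ω : TreeBoundary G o => u (ω.vertex n)) r (measure hG o) ≤
      ENNReal.ofReal (‖Q‖⁻¹ ^ n * sphericalSum q ‖a‖ n) * H := by
    intro n
    have hpos : 0 < ‖Q‖⁻¹ ^ n * sphericalSum q ‖a‖ n :=
      mul_pos (by positivity) (sphericalSum_pos hG.two_le hA1 n)
    rw [← ENNReal.inv_mul_le_iff (ENNReal.ofReal_pos.2 hpos).ne' ENNReal.ofReal_ne_top, hH,
      hardyNorm_eq_iSup hG ω₀ (by linarith) hp2 (by positivity), hQn, hnorm]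
    exact le_iSup (fun n : ℕ => (ENNReal.ofReal (((q : ℝ) ^ (1 / p))⁻¹ ^ n *
      sphericalSum q ((q : ℝ) ^ (2 / p - 1)) n))⁻¹ *
        eLpNorm (fun ω : TreeBoundary G o => u (ω.vertex n)) r (measure hG o)) n
  have hmeas : ∀ n, AEStronglyMeasurable
      ((Q ^ n / sphericalSum q a n) • fun ω : TreeBoundary G o => u (ω.vertex n))
      (measure hG o) := by
    intro n
    let _ : MeasurableSpace V := ⊤
    have : Measurable u := Measurable.of_discrete
    exact (this.comp (measurable_vertex hG n)).aestronglyMeasurable.const_smul _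
  have hlim : ∀ᵐ ω ∂(measure hG o), Tendsto
      (fun n => ((Q ^ n / sphericalSum q a n) • fun ω : TreeBoundary G o => u (ω.vertex n)) ω)
      atTop (𝓝 (F ω)) := by
    filter_upwards [tendsto_ae_condExp_vertexFiltration hG hFint] with ω hω
    refine (tendsto_weighted_sum_div_sphericalSum hG.two_le hA1 hC h hω).congr fun n => ?_
    simp only [Pi.smul_apply, smul_eq_mul, hu]
    have e : Q ^ n * Q⁻¹ ^ n = 1 := by rw [← mul_pow, mul_inv_cancel₀ hQ0, one_pow]
    rw [integral_poissonKernel_mul hG hQ ha hFint ω n, div_mul_eq_mul_div (Q ^ n), ← mul_assoc, e,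
      one_mul]
  have hbound : ENNReal.ofReal C * eLpNorm F r (measure hG o) ≤
      ENNReal.ofReal C * (ENNReal.ofReal C⁻¹ * H) := by
    gcongr
    -- Fatou for `L^r` norms, including `r = ∞`. The factor `Qⁿ / D_n(a)` made the weights sum to
    -- `1`; it costs at most `C⁻¹` against `φ_{iδ_p}(n)⁻¹`.
    refine (Lp.eLpNorm_lim_le_liminf_eLpNorm hmeas F hlim).trans ?_
    refine liminf_le_of_frequently_le' (Eventually.frequently ?_)
    filter_upwards [h] with n hn
    have hSpos := sphericalSum_pos hG.two_le hA1 n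
    have hDpos : 0 < ‖sphericalSum q a n‖ := (mul_pos hC hSpos).trans_le hn
    have hQpos : 0 < ‖Q‖ := norm_pos_iff.2 hQ0
    rw [eLpNorm_const_smul]
    calc _ ≤ ENNReal.ofReal (‖Q ^ n / sphericalSum q a n‖) *
          (ENNReal.ofReal (‖Q‖⁻¹ ^ n * sphericalSum q ‖a‖ n) * H) := by
          rw [← ofReal_norm]
          gcongr
          exact hHn n
      _ = ENNReal.ofReal (sphericalSum q ‖a‖ n / ‖sphericalSum q a n‖) * H := by
          rw [← mul_assoc, ← ENNReal.ofReal_mul (norm_nonneg _), norm_div, norm_pow, inv_pow]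
          congr 2
          field_simp
      _ ≤ _ := by
          gcongr
          rw [div_le_iff₀ hDpos, inv_mul_eq_div, le_div_iff₀ hC]
          linarith
  refine hbound.trans_eq ?_
  rw [← mul_assoc, ← ENNReal.ofReal_mul hC.le, mul_inv_cancel₀ hC.ne', ENNReal.ofReal_one, one_mul]

/-- A lower bound, uniform in `q` and `α`, for the normalized spherical functions. -/
theorem exists_eventually_le_norm_sphericalSum (p : ℝ) (hp1 : 1 ≤ p) (hp2 : p ≤ 2) :
    ∃ C : ℝ, 0 < C ∧ ∀ (q : ℕ) (α : ℝ) (a : ℂ), 2 ≤ q →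
      (p = 2 → ∃ k : ℤ, α = (2 * Real.pi / Real.log q) / 2 * k) →
      a = (q : ℂ) ^ (((2 / p - 1 : ℝ) : ℂ) + 2 * α * Complex.I) →
      ∀ᶠ n in atTop, C * sphericalSum q ‖a‖ n ≤ ‖sphericalSum q a n‖ := by
  rcases hp2.eq_or_lt with rfl | hp2
  · refine ⟨1, one_pos, fun q α a hq hα ha => Eventually.of_forall fun n => ?_⟩
    obtain ⟨k, hk⟩ := hα rfl
    have hq1 : (1 : ℝ) < q := by exact_mod_cast (by omega : 1 < q)
    have hlog : (Real.log q : ℂ) ≠ 0 := by exact_mod_cast (Real.log_pos hq1).ne'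
    -- With `p = 2` and `α = πk / log q`, `a = q^{2iα} = e^{2πik}`.
    have ha1 : a = 1 := by
      have hlogc : Complex.log (q : ℂ) = ((Real.log q : ℝ) : ℂ) := by
        rw [Complex.ofReal_log (by positivity)]; simp
      rw [ha, Complex.cpow_def_of_ne_zero (by exact_mod_cast (by omega : q ≠ 0)), hlogc,
        Complex.exp_eq_one_iff]
      refine ⟨k, ?_⟩
      rw [hk]
      generalize Real.log q = L at hlog
      push_cast
      field_simp
      ring
    subst ha1
    have := sphericalSum_pos hq (A := 1) le_rfl n
    have e : sphericalSum q (1 : ℂ) n = ((sphericalSum q (1 : ℝ) n : ℝ) : ℂ) := by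
      simp [sphericalSum]
    rw [norm_one, e, Complex.norm_real, one_mul]
    exact le_abs_self _
  · have hd : 0 < 2 / p - 1 := by
      rw [sub_pos, lt_div_iff₀ (by linarith)]
      linarith
    -- Taking the smallest degree, `q = 2`, as the lower bound for `|a| = q^(2/p-1)` makes the
    -- constant depend on `p` alone.
    have hA₀ : 1 < (2 : ℝ) ^ (2 / p - 1) := Real.one_lt_rpow one_lt_two hd
    refine ⟨((2 : ℝ) ^ (2 / p - 1) - 1) / (2 * ((2 : ℝ) ^ (2 / p - 1) + 1)),
      div_pos (by linarith) (by linarith), fun q α a hq _ ha => ?_⟩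
    have hq2 : (2 : ℝ) ≤ q := by exact_mod_cast hq
    have hn : ‖a‖ = (q : ℝ) ^ (2 / p - 1) := by
      rw [ha, ← Complex.ofReal_natCast, Complex.norm_cpow_eq_rpow_re_of_pos (by linarith)]
      simp
    refine eventually_le_norm_sphericalSum hq hA₀ ?_ ?_ <;> rw [hn]
    · exact Real.rpow_le_rpow zero_le_two hq2 hd.le
    · refine (Real.rpow_le_rpow_of_exponent_le (by linarith) ?_).trans_eq (Real.rpow_one _)
      rw [sub_le_iff_le_add, div_le_iff₀ (by linarith)]
      linarith

end TreeBoundary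

/-! ### The two-sided estimate -/

theorem mainTheorem4 (p : ℝ) (hp1 : 1 ≤ p) (hp2 : p ≤ 2) :
    ∃ C : ℝ, 0 < C ∧
      ∀ {V : Type*} (G : SimpleGraph V) (q : ℕ) (hG : IsHomogeneousTree G q) (o : V)
        (ω₀ : TreeBoundary G o) (α : ℝ),
        (p = 2 → ∃ k : ℤ, α = (2 * Real.pi / Real.log q) / 2 * k) →
        ∀ r : ℝ≥0∞, 1 ≤ r → ∀ F : TreeBoundary G o → ℂ,
          MemLp F r (TreeBoundary.measure hG o) →
          let z : ℂ := α + Complex.I * ((-TreeBoundary.hardyDelta p : ℝ) : ℂ)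
          ENNReal.ofReal C * eLpNorm F r (TreeBoundary.measure hG o) ≤
              TreeBoundary.hardyNorm hG o ω₀ p r (TreeBoundary.poissonTransform hG o z F) ∧
            TreeBoundary.hardyNorm hG o ω₀ p r (TreeBoundary.poissonTransform hG o z F) ≤
              eLpNorm F r (TreeBoundary.measure hG o) := by
  obtain ⟨C, hC, hlow⟩ := TreeBoundary.exists_eventually_le_norm_sphericalSum p hp1 hp2
  refine ⟨C, hC, ?_⟩
  intro V G q hG o ω₀ α hα r hr F hF z
  have hq0 : (0 : ℝ) < q := by have := hG.two_le; positivity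
  have hqc : (q : ℂ) ≠ 0 := by exact_mod_cast hq0.ne'
  have hp0 : (p : ℂ) ≠ 0 := by exact_mod_cast (by linarith : p ≠ 0)
  set s : ℂ := ((1 / p : ℝ) : ℂ) + α * Complex.I with hs
  have hsre : s.re = 1 / p := by simp [hs]
  have hz : 1 / 2 + Complex.I * z = s := by
    simp only [z, hs, TreeBoundary.hardyDelta]
    rw [mul_add, ← mul_assoc, Complex.I_mul_I]
    push_cast
    ring
  have hP : TreeBoundary.poissonTransform hG o z F = fun x =>
      ∫ ω', (TreeBoundary.poissonKernel q x ω' : ℂ) ^ s * F ω' ∂(TreeBoundary.measure hG o) := by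
    funext x
    rw [TreeBoundary.poissonTransform, hz]
  rw [hP]
  set a : ℂ := (q : ℂ) ^ (((2 / p - 1 : ℝ) : ℂ) + 2 * α * Complex.I) with ha
  have haQ : q * a = ((q : ℂ) ^ s) ^ 2 := by
    rw [ha, ← Complex.cpow_mul_nat]
    nth_rewrite 1 [← Complex.cpow_one (q : ℂ)]
    rw [← Complex.cpow_add _ _ hqc]
    congr 1
    rw [hs]
    push_cast
    ring
  have hnorm : ‖a‖ = (q : ℝ) ^ (2 / p - 1) := by
    rw [ha, ← Complex.ofReal_natCast, Complex.norm_cpow_eq_rpow_re_of_pos hq0]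
    simp
  refine ⟨TreeBoundary.le_hardyNorm_of_eventually_le hG ω₀ hp1 hp2 hsre haQ hnorm hC
    (hlow q α a hG.two_le hα ha) hr hF, ?_⟩
  rw [TreeBoundary.hardyNorm_eq_iSup hG ω₀ (by linarith) hp2 (by positivity)]
  refine iSup_le fun n => ?_
  rw [ENNReal.inv_mul_le_iff ?_ ENNReal.ofReal_ne_top]
  · exact TreeBoundary.eLpNorm_integral_poissonKernel_mul_le hG hp1 hp2 hsre hr hF n
  · rw [ne_eq, ENNReal.ofReal_eq_zero, not_le]
    refine mul_pos (by positivity) (TreeBoundary.sphericalSum_pos hG.two_le ?_ n)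
    refine Real.one_le_rpow (by exact_mod_cast (by have := hG.two_le; omega : 1 ≤ q)) ?_
    rw [sub_nonneg, le_div_iff₀ (by linarith)]
    linarith
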